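/- Let $E=(E^0,E^1,r,s)$ be a directed graph with at least one edge, let $K$ be a field, and let $\mathbb F$ be the free group on $E^1$. Let $L_K(E)$ be the Leavitt path algebra: the associative (not necessarily unital) $K$-algebra generated by pairwise orthogonal idempotents $v$ ($v\in E^0$) and elements $f,f^*$ ($f\in E^1$) subject to $s(f)f=fr(f)=f$ and $r(f)f^*=f^*s(f)=f^*$ for $f \in E^1$, $f^*f'=\delta_{f,f'}r(f)$ for $f,f'\in E^1$, and $v=\sum_{s(f)=v}ff^*$ for every $v\in E^0$ such that $s^{-1}(v)$ is finite and non-empty. Equip $L_K(E)=\bigoplus_{g\in\mathbb F}L_K(E)_g$ with the $\mathbb F$-grading in which $v$ has degree $1$, $f$ has degree $f$ and $f^*$ has degree $f^{-1}$; that is, $L_K(E)_g$ is the $K$-linear span of the words in the generators whose degree in $\mathbb F$ is $g$. Say that a graded ring $R$ is graded unit-regular if it has an identity and every homogeneous $x\in R$ (that is, every nonzero element of some component) can be written as $x=xux$ with $u\in R$ homogeneous and invertible. Then $L_K(E)$ is graded unit-regular if and only if $E$ is a loop, i.e. $E$ consists of exactly one vertex and exactly one edge, which starts and ends at that vertex.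 -/

import Mathlib

universe u v w

/-! ### Graded rings and graded unit-regularity -/

/-- A grading of a (not necessarily unital) associative ring `R` by a group `G`: additive subgroups
`R_g` (`g ∈ G`) such that `R = ⨁ R_g` (internal direct sum) and `R_g R_h ⊆ R_{gh}`. -/
structure GroupGrading (R : Type u) [NonUnitalRing R] (G : Type v) [Group G] where
  /-- the homogeneous component of degree `g` -/
  component : G → AddSubgroup R
  isInternal : ∀ [DecidableEq G], DirectSum.IsInternal component
  mul_mem : ∀ {g h : G} {x y : R}, x ∈ component g → y ∈ component h → x * y ∈ component (g * h)

namespace GroupGrading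

variable {R : Type u} [NonUnitalRing R] {G : Type v} [Group G]

/-- The homogeneous elements are the nonzero elements of the components. -/
def IsHomogeneous (𝒢 : GroupGrading R G) (x : R) : Prop :=
  x ≠ 0 ∧ ∃ g : G, x ∈ 𝒢.component g

/-- `R` is graded unit-regular: `R` is unital, with identity `e`, and every homogeneous `x` can be
written as `x = x u x`, where `u` is homogeneous and invertible in `R`. -/
def IsGradedUnitRegular (𝒢 : GroupGrading R G) : Prop :=
  ∃ e : R, (∀ x : R, e * x = x ∧ x * e = x) ∧
    ∀ x : R, 𝒢.IsHomogeneous x →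
      ∃ u : R, 𝒢.IsHomogeneous u ∧ (∃ t : R, u * t = e ∧ t * u = e) ∧ x = x * u * x

end GroupGrading

/-! ### Directed graphs -/

/-- A directed graph with vertex set `V`, edge set `E`, and source and range maps. -/
structure DirectedGraph (V : Type u) (E : Type v) where
  /-- the source map -/
  s : E → V
  /-- the range map -/
  r : E → V

/-- The graph consists of one vertex and one loop based on it. -/
def DirectedGraph.IsLoop {V : Type u} {E : Type v} (Γ : DirectedGraph V E) : Prop :=
  ∃ (a : V) (f : E), (∀ b : V, b = a) ∧ (∀ f' : E, f' = f) ∧ Γ.s f = a ∧ Γ.r f = a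

/-! ### Leavitt path algebras -/

/-- The generators `v` (`v ∈ E⁰`), `f` and `f*` (`f ∈ E¹`) of a Leavitt path algebra. -/
inductive LeavittGen (V : Type u) (E : Type v) : Type (max u v)
  | vert : V → LeavittGen V E
  | edge : E → LeavittGen V E
  | ghost : E → LeavittGen V E

/-- The free associative (non-unital) `K`-algebra on the symbols `v`, `f`, `f*`: it has the nonempty
words in these symbols as a `K`-basis. -/
abbrev LeavittFree (K : Type w) [Field K] (V : Type u) (E : Type v) : Type (max u v w) :=
  MonoidAlgebra K (FreeSemigroup (LeavittGen V E))

namespace LeavittFree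

variable (K : Type w) [Field K] {V : Type u} {E : Type v}

/-- A generator, as an element of the free algebra. -/
noncomputable def gen (x : LeavittGen V E) : LeavittFree K V E :=
  MonoidAlgebra.single (FreeSemigroup.of x) 1

/-- The symbol `v`. -/
noncomputable abbrev vert (a : V) : LeavittFree K V E := gen K (LeavittGen.vert a)

/-- The symbol `f`. -/
noncomputable abbrev edge (f : E) : LeavittFree K V E := gen K (LeavittGen.edge f)

/-- The symbol `f*`. -/
noncomputable abbrev ghost (f : E) : LeavittFree K V E := gen K (LeavittGen.ghost f)

end LeavittFree

open LeavittFree in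
/-- The defining relations of the Leavitt path algebra. -/
inductive LeavittRel (K : Type w) [Field K] {V : Type u} {E : Type v} (Γ : DirectedGraph V E) :
    LeavittFree K V E → LeavittFree K V E → Prop
  | vert_idem (a : V) : LeavittRel K Γ (vert K a * vert K a) (vert K a)
  | vert_orth (a b : V) (h : a ≠ b) : LeavittRel K Γ (vert K a * vert K b) 0
  | s_edge (f : E) : LeavittRel K Γ (vert K (Γ.s f) * edge K f) (edge K f)
  | edge_r (f : E) : LeavittRel K Γ (edge K f * vert K (Γ.r f)) (edge K f)
  | r_ghost (f : E) : LeavittRel K Γ (vert K (Γ.r f) * ghost K f) (ghost K f)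
  | ghost_s (f : E) : LeavittRel K Γ (ghost K f * vert K (Γ.s f)) (ghost K f)
  | ghost_edge_self (f : E) : LeavittRel K Γ (ghost K f * edge K f) (vert K (Γ.r f))
  | ghost_edge_ne (f f' : E) (h : f ≠ f') : LeavittRel K Γ (ghost K f * edge K f') 0
  | sum_edge_ghost (a : V) (hne : {f : E | Γ.s f = a}.Nonempty)
      (hfin : {f : E | Γ.s f = a}.Finite) :
      LeavittRel K Γ (vert K a) (∑ f ∈ hfin.toFinset, edge K f * ghost K f)

/-- The `K`-algebra congruence generated by the defining relations. -/
inductive LeavittCong (K : Type w) [Field K] {V : Type u} {E : Type v} (Γ : DirectedGraph V E) :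
    LeavittFree K V E → LeavittFree K V E → Prop
  | of {x y} (h : LeavittRel K Γ x y) : LeavittCong K Γ x y
  | refl (x) : LeavittCong K Γ x x
  | symm {x y} (h : LeavittCong K Γ x y) : LeavittCong K Γ y x
  | trans {x y z} (h : LeavittCong K Γ x y) (h' : LeavittCong K Γ y z) : LeavittCong K Γ x z
  | add {x y x' y'} (h : LeavittCong K Γ x y) (h' : LeavittCong K Γ x' y') :
      LeavittCong K Γ (x + x') (y + y')
  | mul {x y x' y'} (h : LeavittCong K Γ x y) (h' : LeavittCong K Γ x' y') :
      LeavittCong K Γ (x * x') (y * y')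
  | smul (c : K) {x y} (h : LeavittCong K Γ x y) : LeavittCong K Γ (c • x) (c • y)

/-- `LeavittCong` as a bundled ring congruence. -/
noncomputable def leavittCon (K : Type w) [Field K] {V : Type u} {E : Type v} (Γ : DirectedGraph V E) :
    RingCon (LeavittFree K V E) where
  r := LeavittCong K Γ
  iseqv := ⟨LeavittCong.refl, LeavittCong.symm, LeavittCong.trans⟩
  add' := LeavittCong.add
  mul' := LeavittCong.mul

/-- The Leavitt path algebra `L_K(E)` of a directed graph: the (not necessarily unital) associative
`K`-algebra presented by the generators `v`, `f`, `f*` and the relations `LeavittRel`. -/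
noncomputable def LeavittPathAlgebra (K : Type w) [Field K] {V : Type u} {E : Type v} (Γ : DirectedGraph V E) :
    Type (max u v w) :=
  (leavittCon K Γ).Quotient

namespace LeavittPathAlgebra

variable (K : Type w) [Field K] {V : Type u} {E : Type v} (Γ : DirectedGraph V E)

noncomputable instance instNonUnitalRing : NonUnitalRing (LeavittPathAlgebra K Γ) :=
  inferInstanceAs (NonUnitalRing (leavittCon K Γ).Quotient)

/-- The quotient map from the free algebra. -/
noncomputable def mk (x : LeavittFree K V E) : LeavittPathAlgebra K Γ :=
  (x : (leavittCon K Γ).Quotient)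

variable {K Γ}

theorem mk_surjective : Function.Surjective (mk K Γ) := fun x =>
  Quotient.inductionOn' x fun a => ⟨a, rfl⟩

theorem mk_eq_of_rel {x y : LeavittFree K V E} (h : LeavittRel K Γ x y) : mk K Γ x = mk K Γ y :=
  Quotient.sound' (LeavittCong.of h)

theorem mk_zero : mk K Γ 0 = 0 := rfl

theorem mk_add (x y : LeavittFree K V E) : mk K Γ (x + y) = mk K Γ x + mk K Γ y := rfl

theorem mk_mul (x y : LeavittFree K V E) : mk K Γ (x * y) = mk K Γ x * mk K Γ y := rfl

noncomputable instance instSMul : SMul K (LeavittPathAlgebra K Γ) where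
  smul c x := Quotient.map' (c • ·) (fun _ _ h => LeavittCong.smul c h) x

theorem mk_smul (c : K) (x : LeavittFree K V E) : mk K Γ (c • x) = c • mk K Γ x := rfl

noncomputable instance instModule : Module K (LeavittPathAlgebra K Γ) where
  one_smul x := by
    obtain ⟨x, rfl⟩ := mk_surjective x
    rw [← mk_smul, one_smul]
  mul_smul c d x := by
    obtain ⟨x, rfl⟩ := mk_surjective x
    rw [← mk_smul, ← mk_smul, ← mk_smul, mul_smul]
  smul_zero c := by rw [← mk_zero, ← mk_smul, smul_zero]
  smul_add c x y := by
    obtain ⟨x, rfl⟩ := mk_surjective x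
    obtain ⟨y, rfl⟩ := mk_surjective y
    rw [← mk_add, ← mk_smul, smul_add]; rfl
  add_smul c d x := by
    obtain ⟨x, rfl⟩ := mk_surjective x
    rw [← mk_smul, add_smul]; rfl
  zero_smul x := by
    obtain ⟨x, rfl⟩ := mk_surjective x
    rw [← mk_smul, zero_smul, mk_zero]

instance instIsScalarTower : IsScalarTower K (LeavittPathAlgebra K Γ) (LeavittPathAlgebra K Γ) where
  smul_assoc c x y := by
    obtain ⟨x, rfl⟩ := mk_surjective x
    obtain ⟨y, rfl⟩ := mk_surjective y
    simp only [smul_eq_mul, ← mk_smul, ← mk_mul, smul_mul_assoc]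

instance instSMulCommClass : SMulCommClass K (LeavittPathAlgebra K Γ) (LeavittPathAlgebra K Γ) where
  smul_comm c x y := by
    obtain ⟨x, rfl⟩ := mk_surjective x
    obtain ⟨y, rfl⟩ := mk_surjective y
    simp only [smul_eq_mul, ← mk_smul, ← mk_mul, mul_smul_comm]

variable (K Γ) in
/-- The quotient map, as a homomorphism of `K`-algebras. -/
noncomputable def mkHom : LeavittFree K V E →ₙₐ[K] LeavittPathAlgebra K Γ where
  toFun := mk K Γ
  map_smul' := mk_smul
  map_zero' := mk_zero
  map_add' := mk_add
  map_mul' := mk_mul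

/-- A homomorphism from the free algebra that respects the defining relations descends to the
Leavitt path algebra. -/
noncomputable def lift {B : Type*} [NonUnitalRing B] [Module K B] (φ : LeavittFree K V E →ₙₐ[K] B)
    (hφ : ∀ x y, LeavittRel K Γ x y → φ x = φ y) : LeavittPathAlgebra K Γ →ₙₐ[K] B :=
  have key : ∀ x y, LeavittCong K Γ x y → φ x = φ y := by
    intro x y h
    induction h with
    | of h => exact hφ _ _ h
    | refl => rfl
    | symm _ ih => exact ih.symm
    | trans _ _ ih ih' => exact ih.trans ih'
    | add _ _ ih ih' => rw [map_add, map_add, ih, ih']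
    | mul _ _ ih ih' => rw [map_mul, map_mul, ih, ih']
    | smul c _ ih => rw [map_smul, map_smul, ih]
  { toFun := fun x => Quotient.liftOn' x φ key
    map_smul' := fun c x => by
      obtain ⟨x, rfl⟩ := mk_surjective x
      exact map_smul φ c x
    map_zero' := map_zero φ
    map_add' := fun x y => by
      obtain ⟨x, rfl⟩ := mk_surjective x
      obtain ⟨y, rfl⟩ := mk_surjective y
      exact map_add φ x y
    map_mul' := fun x y => by
      obtain ⟨x, rfl⟩ := mk_surjective x
      obtain ⟨y, rfl⟩ := mk_surjective y
      exact map_mul φ x y }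

theorem lift_mk {B : Type*} [NonUnitalRing B] [Module K B] (φ : LeavittFree K V E →ₙₐ[K] B)
    (hφ : ∀ x y, LeavittRel K Γ x y → φ x = φ y) (x : LeavittFree K V E) :
    lift (Γ := Γ) φ hφ (mk K Γ x) = φ x := rfl

/-! ### The grading by the free group on the edges -/

/-- The degrees of the generators in the free group on the edges: `v` has degree `1`, `f` has degree
`f`, and `f*` has degree `f⁻¹`. -/
def genDegree : LeavittGen V E → FreeGroup E
  | .vert _ => 1
  | .edge f => FreeGroup.of f
  | .ghost f => (FreeGroup.of f)⁻¹

/-- The degree of a word: the product of the degrees of its letters. -/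
def degree : FreeSemigroup (LeavittGen V E) →ₙ* FreeGroup E := FreeSemigroup.lift genDegree

variable (K Γ) in
/-- The component of degree `g`: the `K`-linear span of the words of degree `g` in the generators. -/
noncomputable def component (g : FreeGroup E) : Submodule K (LeavittPathAlgebra K Γ) :=
  Submodule.span K {x | ∃ m : FreeSemigroup (LeavittGen V E),
    degree m = g ∧ x = mk K Γ (MonoidAlgebra.single m 1)}

theorem mk_single_mem (m : FreeSemigroup (LeavittGen V E)) :
    mk K Γ (MonoidAlgebra.single m 1) ∈ component K Γ (degree m) :=
  Submodule.subset_span ⟨m, rfl, rfl⟩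

theorem component_mul_mem {g h : FreeGroup E} {x y : LeavittPathAlgebra K Γ}
    (hx : x ∈ component K Γ g) (hy : y ∈ component K Γ h) : x * y ∈ component K Γ (g * h) := by
  induction hx using Submodule.span_induction with
  | mem x hx =>
    obtain ⟨m, rfl, rfl⟩ := hx
    induction hy using Submodule.span_induction with
    | mem y hy =>
      obtain ⟨n, rfl, rfl⟩ := hy
      rw [← mk_mul, MonoidAlgebra.single_mul_single, mul_one, ← map_mul]
      exact mk_single_mem _
    | zero => rw [mul_zero]; exact zero_mem _
    | add y z _ _ ihy ihz => rw [mul_add]; exact add_mem ihy ihz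
    | smul c y _ ih => rw [mul_smul_comm]; exact Submodule.smul_mem _ c ih
  | zero => rw [zero_mul]; exact zero_mem _
  | add y z _ _ ihy ihz => rw [add_mul]; exact add_mem ihy ihz
  | smul c y _ ih => rw [smul_mul_assoc]; exact Submodule.smul_mem _ c ih

theorem degree_of (x : LeavittGen V E) : degree (FreeSemigroup.of x) = genDegree x := rfl

variable (K Γ) in
/-- The coaction `m ↦ m ⊗ deg m` on words `m`. -/
noncomputable def preCoaction : LeavittFree K V E →ₙₐ[K]
    MonoidAlgebra (Unitization K (LeavittPathAlgebra K Γ)) (FreeGroup E) :=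
  MonoidAlgebra.liftMagma K
    { toFun := fun m => MonoidAlgebra.single (degree m)
        (Unitization.inr (mk K Γ (MonoidAlgebra.single m 1)))
      map_mul' := fun m n => by
        rw [MonoidAlgebra.single_mul_single, map_mul, ← Unitization.inr_mul, ← mk_mul,
          MonoidAlgebra.single_mul_single, mul_one] }

theorem preCoaction_single (m : FreeSemigroup (LeavittGen V E)) :
    preCoaction K Γ (MonoidAlgebra.single m 1) = MonoidAlgebra.single (degree m)
        (Unitization.inr (mk K Γ (MonoidAlgebra.single m 1))) := by
  simp [preCoaction]

theorem preCoaction_gen (x : LeavittGen V E) :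
    preCoaction K Γ (LeavittFree.gen K x) = MonoidAlgebra.single (genDegree x)
        (Unitization.inr (mk K Γ (LeavittFree.gen K x))) :=
  preCoaction_single _

theorem preCoaction_rel (x y : LeavittFree K V E) (h : LeavittRel K Γ x y) :
    preCoaction K Γ x = preCoaction K Γ y := by
  have hmk := mk_eq_of_rel h
  cases h with
  | sum_edge_ghost a hne hfin =>
    rw [map_sum]
    simp only [map_mul, preCoaction_gen, MonoidAlgebra.single_mul_single, ← Unitization.inr_mul,
      ← mk_mul, genDegree, mul_inv_cancel, hmk]
    change _ = ∑ f ∈ hfin.toFinset, MonoidAlgebra.singleAddHom (1 : FreeGroup E)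
      (Unitization.inrNonUnitalAlgHom K (LeavittPathAlgebra K Γ) (mkHom K Γ _))
    simp only [← map_sum]
    rfl
  | _ => simp [preCoaction_gen, MonoidAlgebra.single_mul_single, ← Unitization.inr_mul,
      ← mk_mul, genDegree, hmk, mk_zero]

variable (K Γ) in
/-- The coaction `x ↦ x ⊗ g` for `x` of degree `g`; its coefficients are the projections onto the
components. -/
noncomputable def coaction : LeavittPathAlgebra K Γ →ₙₐ[K]
    MonoidAlgebra (Unitization K (LeavittPathAlgebra K Γ)) (FreeGroup E) :=
  lift (preCoaction K Γ) preCoaction_rel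

theorem coaction_of_mem {g : FreeGroup E} {x : LeavittPathAlgebra K Γ}
    (hx : x ∈ component K Γ g) :
    coaction K Γ x = MonoidAlgebra.single g (Unitization.inr x) := by
  induction hx using Submodule.span_induction with
  | mem x hx =>
    obtain ⟨m, rfl, rfl⟩ := hx
    exact preCoaction_single m
  | zero => simp
  | add y z _ _ ihy ihz => rw [map_add, ihy, ihz, ← MonoidAlgebra.single_add, Unitization.inr_add]
  | smul c y _ ih => rw [map_smul, ih, MonoidAlgebra.smul_single, Unitization.inr_smul]

theorem component_sup : ⨆ g, component K Γ g = ⊤ := by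
  rw [eq_top_iff]
  rintro x -
  obtain ⟨x, rfl⟩ := mk_surjective x
  induction x using MonoidAlgebra.induction_linear with
  | zero => exact zero_mem _
  | add x y hx hy => exact add_mem hx hy
  | single m c =>
    rw [← mul_one c, ← smul_eq_mul, ← MonoidAlgebra.smul_single, mk_smul]
    exact Submodule.smul_mem _ c (Submodule.mem_iSup_of_mem _ (mk_single_mem m))

theorem component_isInternal [DecidableEq (FreeGroup E)] :
    DirectSum.IsInternal fun g => (component K Γ g).toAddSubgroup := by
  refine ⟨?_, ?_⟩
  · rw [injective_iff_map_eq_zero]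
    intro x hx
    have key : ∀ (g : FreeGroup E) (x : DirectSum (FreeGroup E) fun g => (component K Γ g).toAddSubgroup),
        (coaction K Γ (DirectSum.coeAddMonoidHom (fun g => (component K Γ g).toAddSubgroup) x)).coeff g =
          Unitization.inr (x g : LeavittPathAlgebra K Γ) := by
      intro g x
      induction x using DirectSum.induction_on with
      | zero => simp
      | of i y =>
        rw [DirectSum.coeAddMonoidHom_of, coaction_of_mem y.2]
        by_cases h : i = g
        · subst h; simp
        · simp [h, DirectSum.of_eq_of_ne _ _ _ (Ne.symm h)]
      | add x y hx hy => simp [hx, hy]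
    ext g
    have := key g x
    rw [hx, map_zero] at this
    have h0 : (Unitization.inr (x g : LeavittPathAlgebra K Γ) :
        Unitization K (LeavittPathAlgebra K Γ)) = Unitization.inr 0 := by
      rw [← this]; simp
    simpa using Unitization.inr_injective h0
  · intro x
    have hx : x ∈ ⨆ g, component K Γ g := by rw [component_sup]; trivial
    induction hx using Submodule.iSup_induction' with
    | mem i x hx => exact ⟨DirectSum.of _ i ⟨x, hx⟩, DirectSum.coeAddMonoidHom_of ..⟩
    | zero => exact ⟨0, map_zero _⟩
    | add x y _ _ hx hy =>
      obtain ⟨a, rfl⟩ := hx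
      obtain ⟨b, rfl⟩ := hy
      exact ⟨a + b, map_add ..⟩

variable (K Γ) in
/-- The `𝔽`-grading of the Leavitt path algebra, `𝔽` the free group on the edges. The canonical
isomorphism onto the partial skew group ring `D(X) ⋆ 𝔽`, `v ↦ 1_v δ_1`, `f ↦ 1_f δ_f`,
`f* ↦ 1_{f⁻¹} δ_{f⁻¹}`, identifies this component of degree `g` with `D_g δ_g`: it sends the
spanning words of degree `g` into `D_g δ_g`, and both families are direct sum decompositions. -/
noncomputable def freeGroupGrading : GroupGrading (LeavittPathAlgebra K Γ) (FreeGroup E) where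
  component g := (component K Γ g).toAddSubgroup
  isInternal := component_isInternal (K := K) (Γ := Γ)
  mul_mem := component_mul_mem

/-- Every grading of the `K`-algebra `L_K(E)` in which `v`, `f`, `f*` have degrees `1`, `f`, `f⁻¹`
is the grading above. -/
theorem component_eq_of_gen_mem (𝒢 : GroupGrading (LeavittPathAlgebra K Γ) (FreeGroup E))
    (hsmul : ∀ (c : K) (g : FreeGroup E) (x), x ∈ 𝒢.component g → c • x ∈ 𝒢.component g)
    (hgen : ∀ x : LeavittGen V E, mk K Γ (LeavittFree.gen K x) ∈ 𝒢.component (genDegree x)) :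
    𝒢.component = (freeGroupGrading K Γ).component := by
  classical
  have hword : ∀ m : FreeSemigroup (LeavittGen V E),
      mk K Γ (MonoidAlgebra.single m 1) ∈ 𝒢.component (degree m) := by
    intro m
    induction m using FreeSemigroup.recOnMul with
    | ih1 x => exact hgen x
    | ih2 x y hx hy =>
      rw [map_mul, ← mul_one (1 : K), ← MonoidAlgebra.single_mul_single, mk_mul]
      exact 𝒢.mul_mem hx hy
  have hle : ∀ g, (freeGroupGrading K Γ).component g ≤ 𝒢.component g := by
    intro g x hx
    change x ∈ component K Γ g at hx
    induction hx using Submodule.span_induction with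
    | mem x hx => obtain ⟨m, rfl, rfl⟩ := hx; exact hword m
    | zero => exact zero_mem _
    | add y z _ _ ihy ihz => exact add_mem ihy ihz
    | smul c y _ ih => exact hsmul c g y ih
  funext g
  refine le_antisymm (fun x hx => ?_) (hle g)
  obtain ⟨d, hd⟩ := (freeGroupGrading K Γ).isInternal.2 x
  let d' : DirectSum (FreeGroup E) fun g => 𝒢.component g :=
    DirectSum.map (fun g => AddSubgroup.inclusion (hle g)) d
  have hd' : DirectSum.coeAddMonoidHom 𝒢.component d' = x := by
    rw [← hd]
    simp only [d']
    generalize d = e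
    induction e using DirectSum.induction_on with
    | zero => simp
    | of i y => rw [DirectSum.map_of, DirectSum.coeAddMonoidHom_of, DirectSum.coeAddMonoidHom_of]; rfl
    | add x y hx hy => rw [map_add, map_add, map_add, hx, hy]
  have he : d' = DirectSum.of (fun g => 𝒢.component g) g ⟨x, hx⟩ :=
    𝒢.isInternal.1 (hd'.trans
      (DirectSum.coeAddMonoidHom_of 𝒢.component g ⟨x, hx⟩).symm)
  have hdx : d = DirectSum.of (fun g => (freeGroupGrading K Γ).component g) g (d g) := by
    refine DFinsupp.ext fun h => ?_
    by_cases hh : h = g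
    · subst hh; rw [DirectSum.of_eq_same]
    · rw [DirectSum.of_eq_of_ne _ _ _ hh]
      have h1 : d' h = 0 := by rw [he, DirectSum.of_eq_of_ne _ _ _ hh]
      have h2 : ((d' h : 𝒢.component h) : LeavittPathAlgebra K Γ) = d h := by
        simp only [d', DirectSum.map_apply, AddSubgroup.coe_inclusion]
      exact Subtype.ext (by rw [← h2, h1]; rfl)
  rw [← hd, hdx, DirectSum.coeAddMonoidHom_of]
  exact (d g).2

end LeavittPathAlgebra

/-!
Letting the generators act on functions `V → I → K`, for an infinite set `I` into which the edges
embed, shows that no vertex and no edge vanishes. If `L_K(E)` is graded unit-regular and `f` is an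
edge, then `f = f u f` with `u` invertible, of degree `f⁻¹`. Every element of that degree is a
combination of monomials `α w (f α)*`, hence `u f f* = u` and so `f f* = 1`. But left multiplication
by `f f*` annihilates every vertex other than `s f` and every edge other than `f`. Conversely, over
a loop `f f* = 1 = f* f`, so that the component of degree `1` consists of the scalars and every
component contains an invertible element.
-/

namespace GroupGrading

variable {R : Type u} [NonUnitalRing R] {G : Type v} [Group G] {𝒢 : GroupGrading R G} {e : R}

theorem degree_unique {g h : G} {x : R} (hx : x ≠ 0) (hg : x ∈ 𝒢.component g)
    (hh : x ∈ 𝒢.component h) : g = h := by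
  classical
  by_contra hne
  exact hx <| (AddSubgroup.disjoint_def.1
    (𝒢.isInternal.addSubgroup_iSupIndep.pairwiseDisjoint hne)) hg hh

theorem degree_eq_inv_of_eq_mul_mul {g h : G} {x u : R} (hx : x ≠ 0) (hg : x ∈ 𝒢.component g)
    (hh : u ∈ 𝒢.component h) (hxux : x = x * u * x) : h = g⁻¹ := by
  have hmem : x ∈ 𝒢.component (g * h * g) := hxux ▸ 𝒢.mul_mem (𝒢.mul_mem hg hh) hg
  exact eq_inv_of_mul_eq_one_right (mul_eq_right.1 (degree_unique hx hmem hg))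

theorem IsGradedUnitRegular.exists_left_invertible (h : 𝒢.IsGradedUnitRegular) :
    ∃ e : R, (∀ x, e * x = x ∧ x * e = x) ∧
      ∀ (g : G) (x : R), x ≠ 0 → x ∈ 𝒢.component g → ∃ u ∈ 𝒢.component g⁻¹, ∃ t, t * u = e := by
  obtain ⟨e, he, hreg⟩ := h
  refine ⟨e, he, fun g x hx hg => ?_⟩
  obtain ⟨u, ⟨-, k, hu⟩, ⟨t, -, htu⟩, hxux⟩ := hreg x ⟨hx, g, hg⟩
  obtain rfl := degree_eq_inv_of_eq_mul_mul hx hg hu hxux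
  exact ⟨u, hu, t, htu⟩

theorem isGradedUnitRegular_of_forall_exists_inverse (he : ∀ x, e * x = x ∧ x * e = x)
    (h : ∀ (g : G) (x : R), x ≠ 0 → x ∈ 𝒢.component g →
      ∃ y ∈ 𝒢.component g⁻¹, x * y = e ∧ y * x = e) :
    𝒢.IsGradedUnitRegular := by
  refine ⟨e, he, fun x ⟨hx, g, hg⟩ => ?_⟩
  obtain ⟨y, hy, hxy, hyx⟩ := h g x hx hg
  have hxyx : x = x * y * x := by rw [hxy, (he x).1]
  refine ⟨y, ⟨?_, g⁻¹, hy⟩, ⟨x, hyx, hxy⟩, hxyx⟩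
  rintro rfl
  exact hx (by rw [hxyx, mul_zero, zero_mul])

theorem isGradedUnitRegular_of_exists_right_inverse (he : ∀ x, e * x = x ∧ x * e = x)
    (hone : ∀ x, x ≠ 0 → x ∈ 𝒢.component 1 → ∃ y ∈ 𝒢.component 1, x * y = e ∧ y * x = e)
    (hunit : ∀ g, ∃ q ∈ 𝒢.component g, ∃ p, q * p = e) :
    𝒢.IsGradedUnitRegular := by
  refine isGradedUnitRegular_of_forall_exists_inverse he fun g x hx hg => ?_
  obtain ⟨q, hq, p, hqp⟩ := hunit g⁻¹
  have hxqp : x * q * p = x := by rw [mul_assoc, hqp, (he x).2]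
  have hxq : x * q ≠ 0 := left_ne_zero_of_mul (hxqp.symm ▸ hx)
  obtain ⟨y, hy, hxy, hyx⟩ := hone _ hxq (mul_inv_cancel g ▸ 𝒢.mul_mem hg hq)
  refine ⟨q * y, mul_one g⁻¹ ▸ 𝒢.mul_mem hq hy, by rw [← mul_assoc, hxy], ?_⟩
  calc q * y * x
    _ = q * (y * (x * q)) * p := by rw [mul_assoc q, mul_assoc q, mul_assoc y, hxqp]
    _ = e := by rw [hyx, (he q).2, hqp]

end GroupGrading

namespace LeavittPathAlgebra

variable {K : Type w} [Field K] {V : Type u} {E : Type v} {Γ : DirectedGraph V E}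

/-! ### Generators -/

variable (K Γ) in
/-- The class of a generator in the Leavitt path algebra. -/
noncomputable def gen (x : LeavittGen V E) : LeavittPathAlgebra K Γ := mk K Γ (LeavittFree.gen K x)

variable (K Γ) in
/-- The vertex `a`, as an element of the Leavitt path algebra. -/
noncomputable abbrev vert (a : V) : LeavittPathAlgebra K Γ := gen K Γ (.vert a)

variable (K Γ) in
/-- The edge `f`, as an element of the Leavitt path algebra. -/
noncomputable abbrev edge (f : E) : LeavittPathAlgebra K Γ := gen K Γ (.edge f)

variable (K Γ) in
/-- The ghost edge `f*`, as an element of the Leavitt path algebra. -/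
noncomputable abbrev ghost (f : E) : LeavittPathAlgebra K Γ := gen K Γ (.ghost f)

theorem vert_mul_self (a : V) : vert K Γ a * vert K Γ a = vert K Γ a :=
  mk_eq_of_rel (.vert_idem a)

theorem vert_mul_vert_of_ne {a b : V} (h : a ≠ b) : vert K Γ a * vert K Γ b = 0 :=
  mk_eq_of_rel (.vert_orth a b h)

theorem ghost_mul_edge_self (f : E) : ghost K Γ f * edge K Γ f = vert K Γ (Γ.r f) :=
  mk_eq_of_rel (.ghost_edge_self f)

theorem ghost_mul_edge_of_ne {f f' : E} (h : f ≠ f') : ghost K Γ f * edge K Γ f' = 0 :=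
  mk_eq_of_rel (.ghost_edge_ne f f' h)

theorem vert_eq_sum (a : V) (hne : {f : E | Γ.s f = a}.Nonempty)
    (hfin : {f : E | Γ.s f = a}.Finite) :
    vert K Γ a = ∑ f ∈ hfin.toFinset, edge K Γ f * ghost K Γ f :=
  (mk_eq_of_rel (.sum_edge_ghost a hne hfin)).trans (map_sum (mkHom K Γ) _ _)

theorem edge_mul_ghost_of_unique {f : E} (h : ∀ f', Γ.s f' = Γ.s f → f' = f) :
    edge K Γ f * ghost K Γ f = vert K Γ (Γ.s f) := by
  have hset : {f' : E | Γ.s f' = Γ.s f} = {f} := by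
    ext f'
    exact ⟨h f', congrArg Γ.s⟩
  have hfin : {f' : E | Γ.s f' = Γ.s f}.Finite := hset ▸ Set.finite_singleton f
  have hfinset : hfin.toFinset = {f} := by
    simp only [hset, Set.toFinite_toFinset, Set.toFinset_singleton]
  rw [vert_eq_sum _ ⟨f, rfl⟩ hfin, hfinset, Finset.sum_singleton]

variable (Γ) in
/-- The vertex at which a generator starts, the ghost edge `f*` being traversed from `r f`
to `s f`. -/
def genSource : LeavittGen V E → V
  | .vert a => a
  | .edge f => Γ.s f
  | .ghost f => Γ.r f

variable (Γ) in
/-- The vertex at which a generator ends, the ghost edge `f*` being traversed from `r f`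
to `s f`. -/
def genRange : LeavittGen V E → V
  | .vert a => a
  | .edge f => Γ.r f
  | .ghost f => Γ.s f

theorem vert_genSource_mul_gen (x : LeavittGen V E) :
    vert K Γ (genSource Γ x) * gen K Γ x = gen K Γ x := by
  cases x with
  | vert a => exact vert_mul_self a
  | edge f => exact mk_eq_of_rel (.s_edge f)
  | ghost f => exact mk_eq_of_rel (.r_ghost f)

theorem gen_mul_vert_genRange (x : LeavittGen V E) :
    gen K Γ x * vert K Γ (genRange Γ x) = gen K Γ x := by
  cases x with
  | vert a => exact vert_mul_self a
  | edge f => exact mk_eq_of_rel (.edge_r f)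
  | ghost f => exact mk_eq_of_rel (.ghost_s f)

theorem vert_mul_gen_of_ne {a : V} {x : LeavittGen V E} (h : a ≠ genSource Γ x) :
    vert K Γ a * gen K Γ x = 0 := by
  rw [← vert_genSource_mul_gen, ← mul_assoc, vert_mul_vert_of_ne h, zero_mul]

theorem gen_mul_vert_of_ne {a : V} {x : LeavittGen V E} (h : genRange Γ x ≠ a) :
    gen K Γ x * vert K Γ a = 0 := by
  rw [← gen_mul_vert_genRange, mul_assoc, vert_mul_vert_of_ne h, mul_zero]

theorem gen_mem_component (x : LeavittGen V E) : gen K Γ x ∈ component K Γ (genDegree x) :=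
  mk_single_mem (FreeSemigroup.of x)

theorem mk_single_mul (m n : FreeSemigroup (LeavittGen V E)) :
    mk K Γ (MonoidAlgebra.single (m * n) 1) =
      mk K Γ (MonoidAlgebra.single m 1) * mk K Γ (MonoidAlgebra.single n 1) := by
  rw [← mk_mul, MonoidAlgebra.single_mul_single, mul_one]

@[elab_as_elim]
theorem induction_on {p : LeavittPathAlgebra K Γ → Prop} (x : LeavittPathAlgebra K Γ)
    (gen : ∀ x, p (gen K Γ x)) (zero : p 0) (add : ∀ x y, p x → p y → p (x + y))
    (smul : ∀ (c : K) (x), p x → p (c • x)) (mul : ∀ x y, p x → p y → p (x * y)) : p x := by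
  obtain ⟨x, rfl⟩ := mk_surjective x
  induction x using MonoidAlgebra.induction_linear with
  | zero => exact zero
  | add x y hx hy => exact add _ _ hx hy
  | single m c =>
    rw [← mul_one c, ← smul_eq_mul, ← MonoidAlgebra.smul_single, mk_smul]
    refine smul c _ ?_
    induction m using FreeSemigroup.recOnMul with
    | ih1 x => exact gen x
    | ih2 x m hx hm => rw [mk_single_mul]; exact mul _ _ hx hm

end LeavittPathAlgebra

/-! ### Representations -/

/-- A Leavitt `Γ`-family in a ring `B`: elements indexed by the vertices, the edges and the ghost
edges of `Γ` that satisfy the defining relations of the Leavitt path algebra. -/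
structure LeavittFamily {V : Type u} {E : Type v} (Γ : DirectedGraph V E) (B : Type*)
    [NonUnitalRing B] where
  vert : V → B
  edge : E → B
  ghost : E → B
  vert_idem : ∀ a, vert a * vert a = vert a
  vert_orth : ∀ a b, a ≠ b → vert a * vert b = 0
  s_edge : ∀ f, vert (Γ.s f) * edge f = edge f
  edge_r : ∀ f, edge f * vert (Γ.r f) = edge f
  r_ghost : ∀ f, vert (Γ.r f) * ghost f = ghost f
  ghost_s : ∀ f, ghost f * vert (Γ.s f) = ghost f
  ghost_edge_self : ∀ f, ghost f * edge f = vert (Γ.r f)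
  ghost_edge_ne : ∀ f f', f ≠ f' → ghost f * edge f' = 0
  sum_edge_ghost : ∀ a, {f : E | Γ.s f = a}.Nonempty → ∀ hfin : {f : E | Γ.s f = a}.Finite,
    vert a = ∑ f ∈ hfin.toFinset, edge f * ghost f

namespace LeavittFamily

variable {V : Type u} {E : Type v} {Γ : DirectedGraph V E} {B : Type*} [NonUnitalRing B]
  (F : LeavittFamily Γ B)

/-- The family as a single function on the generators. -/
def gen : LeavittGen V E → B
  | .vert a => F.vert a
  | .edge f => F.edge f
  | .ghost f => F.ghost f

variable (K : Type w) [Field K] [Module K B] [IsScalarTower K B B] [SMulCommClass K B B]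

/-- The homomorphism from the free algebra that sends the generators to the elements of a
family. -/
noncomputable def freeLift : LeavittFree K V E →ₙₐ[K] B :=
  MonoidAlgebra.liftMagma K (FreeSemigroup.lift F.gen)

theorem freeLift_gen (x : LeavittGen V E) :
    F.freeLift K (LeavittFree.gen K x) = F.gen x := by
  simp [freeLift, LeavittFree.gen]

theorem freeLift_eq_of_rel (x y : LeavittFree K V E) (h : LeavittRel K Γ x y) :
    F.freeLift K x = F.freeLift K y := by
  cases h <;> simp only [map_mul, map_zero, map_sum, freeLift_gen]
  case vert_idem a => exact F.vert_idem a
  case vert_orth a b h => exact F.vert_orth a b h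
  case s_edge f => exact F.s_edge f
  case edge_r f => exact F.edge_r f
  case r_ghost f => exact F.r_ghost f
  case ghost_s f => exact F.ghost_s f
  case ghost_edge_self f => exact F.ghost_edge_self f
  case ghost_edge_ne f f' h => exact F.ghost_edge_ne f f' h
  case sum_edge_ghost a hne hfin => exact F.sum_edge_ghost a hne hfin

/-- The universal property of the Leavitt path algebra. -/
noncomputable def lift : LeavittPathAlgebra K Γ →ₙₐ[K] B :=
  LeavittPathAlgebra.lift (F.freeLift K) (F.freeLift_eq_of_rel K)

theorem lift_gen (x : LeavittGen V E) : F.lift K (LeavittPathAlgebra.gen K Γ x) = F.gen x :=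
  F.freeLift_gen K x

end LeavittFamily

section BlockSingle

variable {R : Type*} [Semiring R] {ι M : Type*} [DecidableEq ι] [AddCommMonoid M] [Module R M]

/-- The endomorphism of `ι → M` whose block matrix has the block `x` in position `(i, j)` and is
zero elsewhere: `Matrix.single` for an index type that may be infinite. -/
def blockSingle (i j : ι) : Module.End R M →+ Module.End R (ι → M) where
  toFun x := LinearMap.single R (fun _ => M) i ∘ₗ x ∘ₗ LinearMap.proj j
  map_zero' := by rw [LinearMap.zero_comp, LinearMap.comp_zero]
  map_add' x y := by rw [LinearMap.add_comp, LinearMap.comp_add]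

theorem blockSingle_apply (i j : ι) (x : Module.End R M) (φ : ι → M) :
    blockSingle i j x φ = Pi.single i (x (φ j)) := rfl

theorem blockSingle_mul_blockSingle_same (i j k : ι) (x y : Module.End R M) :
    blockSingle i j x * blockSingle j k y = blockSingle i k (x * y) := by
  ext1 φ
  simp only [Module.End.mul_apply, blockSingle_apply, Pi.single_eq_same]

theorem blockSingle_mul_blockSingle_of_ne {j k : ι} (h : j ≠ k) (i l : ι)
    (x y : Module.End R M) : blockSingle i j x * blockSingle k l y = 0 := by
  ext1 φ
  rw [Module.End.mul_apply, blockSingle_apply, blockSingle_apply, Pi.single_eq_of_ne h, map_zero,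
    Pi.single_zero, LinearMap.zero_apply]

theorem blockSingle_injective (i j : ι) :
    Function.Injective (blockSingle i j : Module.End R M →+ Module.End R (ι → M)) := by
  intro x y h
  ext m
  have hm := congrFun (LinearMap.congr_fun h (Pi.single j m)) i
  simpa only [blockSingle_apply, Pi.single_eq_same] using hm

end BlockSingle

/-- An algebraic branching system on `V × I`, in which the vertex `a` owns `{a} × I` and the edge
`f` maps `{r f} × I` injectively into `{s f} × I` by `(r f, i) ↦ (s f, shift f i)`; the ranges of
the edges emitted by a vertex `a` that is not a sink partition `{a} × I`. -/
structure BranchingSystem {V : Type u} {E : Type v} (Γ : DirectedGraph V E) (I : Type*) where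
  shift : E → I → I
  shift_inj : ∀ {f f' i i'}, Γ.s f = Γ.s f' → shift f i = shift f' i' → f = f' ∧ i = i'
  exists_shift_eq : ∀ f i, ∃ f' i', Γ.s f' = Γ.s f ∧ shift f' i' = i

theorem nonempty_prod_equiv_right {F : Type u} {I : Type v} [Nonempty F] [Infinite I]
    (ι : F ↪ I) : Nonempty (F × I ≃ I) := by
  rw [← Cardinal.lift_mk_eq', Cardinal.mk_prod, Cardinal.lift_mul, Cardinal.lift_lift,
    Cardinal.lift_lift, Cardinal.lift_umax.{v, u}]
  refine Cardinal.mul_eq_right ?_ ?_ ?_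
  · exact Cardinal.aleph0_le_lift.2 (Cardinal.aleph0_le_mk I)
  · exact Cardinal.lift_mk_le'.2 ⟨ι⟩
  · exact (Cardinal.lift_eq_zero.not).2 (Cardinal.mk_ne_zero F)

namespace BranchingSystem

variable {V : Type u} {E : Type v} {Γ : DirectedGraph V E} {I : Type*}

theorem nonempty_of_embedding (Γ : DirectedGraph V E) [Infinite I] (ι : E ↪ I) :
    Nonempty (BranchingSystem Γ I) := by
  have hequiv (a : Set.range Γ.s) : Nonempty ({f : E // Γ.s f = a} × I ≃ I) := by
    obtain ⟨-, f, rfl⟩ := a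
    have : Nonempty {f' : E // Γ.s f' = Γ.s f} := ⟨f, rfl⟩
    exact nonempty_prod_equiv_right ((Function.Embedding.subtype _).trans ι)
  let e (a : Set.range Γ.s) := (hequiv a).some
  let shift (f : E) (i : I) : I := e ⟨Γ.s f, f, rfl⟩ (⟨f, rfl⟩, i)
  have hshift (a : V) (ha : a ∈ Set.range Γ.s) (f : E) (hf : Γ.s f = a) (i : I) :
      shift f i = e ⟨a, ha⟩ (⟨f, hf⟩, i) := by
    subst hf
    rfl
  refine ⟨⟨shift, fun {f f' i i'} hs h => ?_, fun f i => ?_⟩⟩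
  · have heq := (e ⟨Γ.s f, f, rfl⟩).injective (h.trans (hshift _ ⟨f, rfl⟩ f' hs.symm i'))
    exact ⟨congrArg (fun p => p.1.1) heq, congrArg Prod.snd heq⟩
  · let p := (e ⟨Γ.s f, f, rfl⟩).symm i
    exact ⟨p.1, p.2, p.1.2, (hshift _ ⟨f, rfl⟩ p.1 p.1.2 p.2).trans (Equiv.apply_symm_apply _ i)⟩

variable (R : Type*) [Ring R] (b : BranchingSystem Γ I)

theorem shift_injective (f : E) : Function.Injective (b.shift f) :=
  fun _ _ h => (b.shift_inj rfl h).2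

/-- The action of the edge `f` on functions on `I`: transport along `shift f`. -/
noncomputable def push (f : E) : Module.End R (I → R) :=
  Function.ExtendByZero.linearMap R (b.shift f)

/-- The action of the ghost edge `f*` on functions on `I`: restriction along `shift f`. -/
def pull (f : E) : Module.End R (I → R) :=
  LinearMap.funLeft R R (b.shift f)

variable {R}

theorem push_apply_shift (f : E) (φ : I → R) (i : I) : b.push R f φ (b.shift f i) = φ i :=
  (b.shift_injective f).extend_apply φ (0 : I → R) i

theorem push_apply_shift_of_ne {f f' : E} (hs : Γ.s f = Γ.s f') (h : f ≠ f') (φ : I → R) (i : I) :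
    b.push R f φ (b.shift f' i) = 0 :=
  Function.extend_apply' φ (0 : I → R) _ fun ⟨_, hj⟩ => h (b.shift_inj hs hj).1

variable (R)

theorem pull_mul_push_self (f : E) : b.pull R f * b.push R f = 1 :=
  LinearMap.ext fun φ => funext fun i => b.push_apply_shift f φ i

theorem pull_mul_push_of_ne {f f' : E} (hs : Γ.s f = Γ.s f') (h : f ≠ f') :
    b.pull R f * b.push R f' = 0 :=
  LinearMap.ext fun φ => funext fun i => b.push_apply_shift_of_ne hs.symm h.symm φ i

theorem sum_push_mul_pull {a : V} (hne : {f : E | Γ.s f = a}.Nonempty)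
    (hfin : {f : E | Γ.s f = a}.Finite) :
    ∑ f ∈ hfin.toFinset, b.push R f * b.pull R f = 1 := by
  refine LinearMap.ext fun φ => funext fun i => ?_
  obtain ⟨f₀, rfl⟩ := hne
  obtain ⟨f, j, hs, rfl⟩ := b.exists_shift_eq f₀ i
  rw [LinearMap.sum_apply, Finset.sum_apply, Finset.sum_eq_single_of_mem f (hfin.mem_toFinset.2 hs)]
  · exact b.push_apply_shift f _ j
  · intro f' hf' hne
    exact b.push_apply_shift_of_ne ((hfin.mem_toFinset.1 hf').trans hs.symm) hne _ j

variable [DecidableEq V]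

/-- The representation of the Leavitt path algebra on the functions `V → I → R`. -/
noncomputable def leavittFamily : LeavittFamily Γ (Module.End R (V → I → R)) where
  vert a := blockSingle a a 1
  edge f := blockSingle (Γ.s f) (Γ.r f) (b.push R f)
  ghost f := blockSingle (Γ.r f) (Γ.s f) (b.pull R f)
  vert_idem a := by rw [blockSingle_mul_blockSingle_same, mul_one]
  vert_orth a a' h := blockSingle_mul_blockSingle_of_ne h ..
  s_edge f := by rw [blockSingle_mul_blockSingle_same, one_mul]
  edge_r f := by rw [blockSingle_mul_blockSingle_same, mul_one]
  r_ghost f := by rw [blockSingle_mul_blockSingle_same, one_mul]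
  ghost_s f := by rw [blockSingle_mul_blockSingle_same, mul_one]
  ghost_edge_self f := by rw [blockSingle_mul_blockSingle_same, pull_mul_push_self]
  ghost_edge_ne f f' h := by
    by_cases hs : Γ.s f = Γ.s f'
    · rw [← hs, blockSingle_mul_blockSingle_same, b.pull_mul_push_of_ne R hs h, map_zero]
    · exact blockSingle_mul_blockSingle_of_ne hs ..
  sum_edge_ghost a hne hfin := by
    rw [← b.sum_push_mul_pull R hne hfin, map_sum]
    refine Finset.sum_congr rfl fun f hf => ?_
    obtain rfl := hfin.mem_toFinset.1 hf
    rw [blockSingle_mul_blockSingle_same]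

end BranchingSystem

namespace LeavittPathAlgebra

variable {K : Type w} [Field K] {V : Type u} {E : Type v} {Γ : DirectedGraph V E}

theorem vert_ne_zero (a : V) : vert K Γ a ≠ 0 := by
  classical
  obtain ⟨b⟩ := BranchingSystem.nonempty_of_embedding (I := ℕ ⊕ E) Γ Function.Embedding.inr
  intro h
  have hblock : blockSingle a a (1 : Module.End K (ℕ ⊕ E → K)) = 0 := by
    rw [← map_zero ((b.leavittFamily K).lift K), ← h, LeavittFamily.lift_gen]
    rfl
  exact one_ne_zero (blockSingle_injective a a (hblock.trans (map_zero _).symm))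

theorem edge_ne_zero (f : E) : edge K Γ f ≠ 0 := by
  intro h
  apply vert_ne_zero (K := K) (Γ := Γ) (Γ.r f)
  rw [← ghost_mul_edge_self, h, mul_zero]

/-! ### Monomials -/

/-- The degree of a list of edges, as a product in the free group. -/
def pathDegree (α : List E) : FreeGroup E := (α.map FreeGroup.of).prod

@[simp]
theorem pathDegree_nil : pathDegree ([] : List E) = 1 := rfl

@[simp]
theorem pathDegree_cons (f : E) (α : List E) :
    pathDegree (f :: α) = FreeGroup.of f * pathDegree α :=
  List.prod_cons

@[simp]
theorem pathDegree_append (α β : List E) :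
    pathDegree (α ++ β) = pathDegree α * pathDegree β := by
  rw [pathDegree, List.map_append, List.prod_append, pathDegree, pathDegree]

theorem pathDegree_eq_mk (α : List E) :
    pathDegree α = FreeGroup.mk (α.map fun f => (f, true)) := by
  induction α with
  | nil => rfl
  | cons f α ih => rw [pathDegree_cons, ih]; rfl

theorem toWord_pathDegree [DecidableEq E] (α : List E) :
    (pathDegree α).toWord = α.map fun f => (f, true) := by
  have hred : FreeGroup.IsReduced (α.map fun f => (f, true)) :=
    (List.isChain_map _).2 (List.pairwise_of_forall fun _ _ _ => rfl).isChain
  rw [pathDegree_eq_mk, FreeGroup.toWord_mk, hred.reduce_eq]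

theorem pathDegree_injective : Function.Injective (pathDegree (E := E)) := by
  classical
  intro α β h
  have hword := congrArg FreeGroup.toWord h
  rw [toWord_pathDegree, toWord_pathDegree] at hword
  exact List.map_injective_iff.2 (fun _ _ => congrArg Prod.fst) hword

/-- The element `x β*`, where `β* = fₙ* ⋯ f₁*` for the list `β = f₁ ⋯ fₙ` of edges. -/
noncomputable def mulGhosts (x : LeavittPathAlgebra K Γ) (β : List E) : LeavittPathAlgebra K Γ :=
  β.foldr (fun f y => y * ghost K Γ f) x

variable (K Γ) in
/-- The element `α w β*`, for a vertex `w` and lists `α`, `β` of edges, which need not be paths. -/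
noncomputable def monomial (w : V) (α β : List E) : LeavittPathAlgebra K Γ :=
  α.foldr (fun f y => edge K Γ f * y) (mulGhosts (vert K Γ w) β)

theorem mul_mulGhosts (x y : LeavittPathAlgebra K Γ) (β : List E) :
    x * mulGhosts y β = mulGhosts (x * y) β := by
  induction β with
  | nil => rfl
  | cons f β ih => simp only [mulGhosts, List.foldr_cons] at ih ⊢; rw [← mul_assoc, ih]

theorem zero_mulGhosts (β : List E) : mulGhosts (0 : LeavittPathAlgebra K Γ) β = 0 := by
  simpa only [zero_mul] using (mul_mulGhosts (0 : LeavittPathAlgebra K Γ) 0 β).symm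

theorem monomial_nil_left (w : V) (β : List E) :
    monomial K Γ w [] β = mulGhosts (vert K Γ w) β := rfl

theorem monomial_cons_left (w : V) (f : E) (α β : List E) :
    monomial K Γ w (f :: α) β = edge K Γ f * monomial K Γ w α β := rfl

theorem monomial_cons_right (w : V) (f : E) (α β : List E) :
    monomial K Γ w α (f :: β) = monomial K Γ w α β * ghost K Γ f := by
  induction α with
  | nil => rfl
  | cons f' α ih => rw [monomial_cons_left, ih, monomial_cons_left, mul_assoc]

theorem mulGhosts_ghost (f : E) (β : List E) :
    mulGhosts (ghost K Γ f) β = monomial K Γ (Γ.r f) [] (β ++ [f]) := by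
  have h : vert K Γ (Γ.r f) * ghost K Γ f = ghost K Γ f := vert_genSource_mul_gen (.ghost f)
  rw [monomial_nil_left, mulGhosts, mulGhosts, List.foldr_append, List.foldr_cons,
    List.foldr_nil, h]

theorem vert_mul_monomial (a w : V) (α β : List E) :
    vert K Γ a * monomial K Γ w α β = 0 ∨
      vert K Γ a * monomial K Γ w α β = monomial K Γ w α β := by
  cases α with
  | nil =>
    rw [monomial_nil_left, mul_mulGhosts]
    by_cases h : a = w
    · exact .inr (by rw [h, vert_mul_self])
    · exact .inl (by rw [vert_mul_vert_of_ne h, zero_mulGhosts])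
  | cons f α =>
    rw [monomial_cons_left, ← mul_assoc]
    by_cases h : a = genSource Γ (.edge f)
    · exact .inr (by rw [h, vert_genSource_mul_gen])
    · exact .inl (by rw [vert_mul_gen_of_ne h, zero_mul])

variable (K Γ) in
/-- The span of the monomials `α w β*` of degree `g`. -/
noncomputable def monomialSpan (g : FreeGroup E) : Submodule K (LeavittPathAlgebra K Γ) :=
  Submodule.span K {x | ∃ w α β, pathDegree α * (pathDegree β)⁻¹ = g ∧ x = monomial K Γ w α β}

theorem monomial_mem_monomialSpan {g : FreeGroup E} (w : V) {α β : List E}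
    (h : pathDegree α * (pathDegree β)⁻¹ = g) : monomial K Γ w α β ∈ monomialSpan K Γ g :=
  Submodule.subset_span ⟨w, α, β, h, rfl⟩

theorem vert_mul_monomial_mem_monomialSpan {g : FreeGroup E} (a w : V) {α β : List E}
    (h : pathDegree α * (pathDegree β)⁻¹ = g) :
    vert K Γ a * monomial K Γ w α β ∈ monomialSpan K Γ g := by
  rcases vert_mul_monomial (K := K) (Γ := Γ) a w α β with h0 | h1
  · rw [h0]
    exact zero_mem _
  · rw [h1]
    exact monomial_mem_monomialSpan w h

theorem ghost_mul_monomial_mem_monomialSpan (f : E) (w : V) (α β : List E) :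
    ghost K Γ f * monomial K Γ w α β ∈
      monomialSpan K Γ ((FreeGroup.of f)⁻¹ * (pathDegree α * (pathDegree β)⁻¹)) := by
  cases α with
  | nil =>
    rw [monomial_nil_left, mul_mulGhosts]
    by_cases h : genRange Γ (.ghost f) = w
    · rw [← h, gen_mul_vert_genRange, mulGhosts_ghost]
      exact monomial_mem_monomialSpan _ (by simp)
    · rw [gen_mul_vert_of_ne h, zero_mulGhosts]
      exact zero_mem _
  | cons f' α =>
    rw [monomial_cons_left, ← mul_assoc (ghost K Γ f)]
    by_cases h : f = f'
    · subst h
      rw [ghost_mul_edge_self]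
      exact vert_mul_monomial_mem_monomialSpan _ w (by simp [mul_assoc])
    · rw [ghost_mul_edge_of_ne h, zero_mul]
      exact zero_mem _

theorem gen_mul_mem_monomialSpan (x : LeavittGen V E) {g : FreeGroup E}
    {y : LeavittPathAlgebra K Γ} (hy : y ∈ monomialSpan K Γ g) :
    gen K Γ x * y ∈ monomialSpan K Γ (genDegree x * g) := by
  induction hy using Submodule.span_induction with
  | mem y hy =>
    obtain ⟨w, α, β, rfl, rfl⟩ := hy
    cases x with
    | vert a => exact vert_mul_monomial_mem_monomialSpan a w (one_mul _).symm
    | edge f => exact monomial_mem_monomialSpan (α := f :: α) w (by simp [genDegree, mul_assoc])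
    | ghost f => exact ghost_mul_monomial_mem_monomialSpan f w α β
  | zero => rw [mul_zero]; exact zero_mem _
  | add y z _ _ hy hz => rw [mul_add]; exact add_mem hy hz
  | smul c y _ hy => rw [mul_smul_comm]; exact Submodule.smul_mem _ c hy

theorem gen_mem_monomialSpan (x : LeavittGen V E) :
    gen K Γ x ∈ monomialSpan K Γ (genDegree x) := by
  have hvert : vert K Γ (genRange Γ x) ∈ monomialSpan K Γ 1 :=
    monomial_mem_monomialSpan (α := []) (β := []) _ (by simp)
  simpa only [gen_mul_vert_genRange, mul_one] using gen_mul_mem_monomialSpan x hvert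

theorem component_le_monomialSpan (g : FreeGroup E) :
    component K Γ g ≤ monomialSpan K Γ g := by
  refine Submodule.span_le.2 ?_
  rintro _ ⟨m, rfl, rfl⟩
  induction m using FreeSemigroup.recOnMul with
  | ih1 x => exact gen_mem_monomialSpan x
  | ih2 x m _ hm => rw [mk_single_mul, map_mul]; exact gen_mul_mem_monomialSpan x hm

/-- Since lists of edges are determined by their degrees, the monomials `α w β*` of degree `f⁻¹`
have `β = f α`, hence end in `f*`. -/
theorem mul_edge_mul_ghost_of_mem {f : E} {x : LeavittPathAlgebra K Γ}
    (hx : x ∈ component K Γ (FreeGroup.of f)⁻¹) : x * (edge K Γ f * ghost K Γ f) = x := by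
  replace hx : x ∈ monomialSpan K Γ (FreeGroup.of f)⁻¹ := component_le_monomialSpan _ hx
  induction hx using Submodule.span_induction with
  | mem x hx =>
    obtain ⟨w, α, β, hdeg, rfl⟩ := hx
    obtain rfl : f :: α = β := by
      apply pathDegree_injective
      rw [pathDegree_cons, ← inv_inv (FreeGroup.of f), ← hdeg]
      group
    have hghost : ghost K Γ f * (edge K Γ f * ghost K Γ f) = ghost K Γ f := by
      rw [← mul_assoc, ghost_mul_edge_self]
      exact vert_genSource_mul_gen (.ghost f)
    rw [monomial_cons_right, mul_assoc, hghost]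
  | zero => exact zero_mul _
  | add x y _ _ hx hy => rw [add_mul, hx, hy]
  | smul c x _ hx => rw [smul_mul_assoc, hx]

/-! ### Graded unit-regularity -/

theorem isLoop_of_edge_mul_ghost_eq_identity {e : LeavittPathAlgebra K Γ}
    (he : ∀ x, e * x = x ∧ x * e = x) {f : E} (hf : edge K Γ f * ghost K Γ f = e) :
    Γ.IsLoop := by
  have hs : e = vert K Γ (Γ.s f) := by
    have hghost : ghost K Γ f * vert K Γ (Γ.s f) = ghost K Γ f :=
      gen_mul_vert_genRange (.ghost f)
    rw [← (he (vert K Γ (Γ.s f))).1, ← hf, mul_assoc, hghost]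
  have hV (a : V) : a = Γ.s f := by
    by_contra hne
    apply vert_ne_zero (K := K) (Γ := Γ) a
    rw [← (he (vert K Γ a)).2, hs, vert_mul_vert_of_ne hne]
  have hE (f' : E) : f' = f := by
    by_contra hne
    apply edge_ne_zero (K := K) (Γ := Γ) f'
    rw [← (he (edge K Γ f')).1, ← hf, mul_assoc, ghost_mul_edge_of_ne (Ne.symm hne), mul_zero]
  exact ⟨Γ.s f, f, hV, hE, rfl, hV (Γ.r f)⟩

theorem isLoop_of_isGradedUnitRegular [Nonempty E]
    (h : (freeGroupGrading K Γ).IsGradedUnitRegular) : Γ.IsLoop := by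
  obtain ⟨e, he, hinv⟩ := h.exists_left_invertible
  let f := Classical.arbitrary E
  obtain ⟨u, hu, t, htu⟩ := hinv _ (edge K Γ f) (edge_ne_zero f) (gen_mem_component (.edge f))
  refine isLoop_of_edge_mul_ghost_eq_identity he (f := f) ?_
  calc edge K Γ f * ghost K Γ f
    _ = t * (u * (edge K Γ f * ghost K Γ f)) := by rw [← mul_assoc, htu, (he _).1]
    _ = e := by rw [mul_edge_mul_ghost_of_mem hu, htu]

section Subsingleton

variable [Subsingleton V]

theorem vert_mul_and_mul_vert (a : V) (x : LeavittPathAlgebra K Γ) :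
    vert K Γ a * x = x ∧ x * vert K Γ a = x := by
  induction x using induction_on with
  | gen x =>
    exact ⟨by rw [Subsingleton.elim a (genSource Γ x), vert_genSource_mul_gen],
      by rw [Subsingleton.elim a (genRange Γ x), gen_mul_vert_genRange]⟩
  | zero => exact ⟨mul_zero _, zero_mul _⟩
  | add x y hx hy => exact ⟨by rw [mul_add, hx.1, hy.1], by rw [add_mul, hx.2, hy.2]⟩
  | smul c x hx => exact ⟨by rw [mul_smul_comm, hx.1], by rw [smul_mul_assoc, hx.2]⟩
  | mul x y hx hy => exact ⟨by rw [← mul_assoc, hx.1], by rw [mul_assoc, hy.2]⟩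

variable [Subsingleton E]

theorem edge_mul_ghost_eq_vert (a : V) (f : E) : edge K Γ f * ghost K Γ f = vert K Γ a := by
  rw [edge_mul_ghost_of_unique fun f' _ => Subsingleton.elim f' f, Subsingleton.elim (Γ.s f) a]

theorem monomial_self (a : V) (α : List E) : monomial K Γ a α α = vert K Γ a := by
  induction α with
  | nil => rfl
  | cons f α ih =>
    rw [monomial_cons_right, monomial_cons_left, ih, (vert_mul_and_mul_vert a _).2,
      edge_mul_ghost_eq_vert a]

theorem component_one_le_span_vert (a : V) : component K Γ 1 ≤ Submodule.span K {vert K Γ a} := by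
  refine (component_le_monomialSpan 1).trans (Submodule.span_mono ?_)
  rintro _ ⟨w, α, β, hdeg, rfl⟩
  obtain rfl := pathDegree_injective (mul_inv_eq_one.1 hdeg)
  rw [Subsingleton.elim w a]
  exact monomial_self a α

theorem exists_inverse_of_mem_component_one (a : V) {x : LeavittPathAlgebra K Γ} (hx : x ≠ 0)
    (hx1 : x ∈ component K Γ 1) :
    ∃ y ∈ component K Γ 1, x * y = vert K Γ a ∧ y * x = vert K Γ a := by
  obtain ⟨c, rfl⟩ := Submodule.mem_span_singleton.1 (component_one_le_span_vert a hx1)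
  have hc : c ≠ 0 := left_ne_zero_of_smul hx
  refine ⟨c⁻¹ • vert K Γ a, Submodule.smul_mem _ _ (gen_mem_component (.vert a)), ?_, ?_⟩
  · rw [smul_mul_smul_comm, mul_inv_cancel₀ hc, one_smul, vert_mul_self]
  · rw [smul_mul_smul_comm, inv_mul_cancel₀ hc, one_smul, vert_mul_self]

theorem exists_invertible_mem_component (a : V) (g : FreeGroup E) :
    ∃ p ∈ component K Γ g, ∃ q ∈ component K Γ g⁻¹,
      p * q = vert K Γ a ∧ q * p = vert K Γ a := by
  induction g using FreeGroup.induction_on with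
  | C1 =>
    have ha : vert K Γ a ∈ component K Γ 1 := gen_mem_component (.vert a)
    exact ⟨_, ha, _, inv_one (G := FreeGroup E) ▸ ha, vert_mul_self a, vert_mul_self a⟩
  | of f =>
    refine ⟨_, gen_mem_component (.edge f), _, gen_mem_component (.ghost f),
      edge_mul_ghost_eq_vert a f, ?_⟩
    rw [ghost_mul_edge_self, Subsingleton.elim (Γ.r f) a]
  | inv_of f h =>
    obtain ⟨p, hp, q, hq, hpq, hqp⟩ := h
    exact ⟨q, hq, p, (inv_inv (FreeGroup.of f)).symm ▸ hp, hqp, hpq⟩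
  | mul g h hg hh =>
    obtain ⟨p, hp, q, hq, hpq, hqp⟩ := hg
    obtain ⟨p', hp', q', hq', hpq', hqp'⟩ := hh
    refine ⟨p * p', component_mul_mem hp hp', q' * q, ?_, ?_, ?_⟩
    · rw [mul_inv_rev]
      exact component_mul_mem hq' hq
    · rw [mul_assoc, ← mul_assoc p', hpq', (vert_mul_and_mul_vert a q).1, hpq]
    · rw [mul_assoc, ← mul_assoc q, hqp, (vert_mul_and_mul_vert a p').1, hqp']

variable (K Γ) in
theorem isGradedUnitRegular_of_subsingleton [Nonempty V] :
    (freeGroupGrading K Γ).IsGradedUnitRegular :=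
  have a : V := Classical.arbitrary V
  GroupGrading.isGradedUnitRegular_of_exists_right_inverse (vert_mul_and_mul_vert a)
    (fun _ hx hx1 => exists_inverse_of_mem_component_one a hx hx1)
    fun g =>
      let ⟨p, hp, q, _, hpq, _⟩ := exists_invertible_mem_component a g
      ⟨p, hp, q, hpq⟩

end Subsingleton

theorem isGradedUnitRegular_of_isLoop (h : Γ.IsLoop) :
    (freeGroupGrading K Γ).IsGradedUnitRegular := by
  obtain ⟨a, f, hV, hE, -, -⟩ := h
  have : Nonempty V := ⟨a⟩
  have : Subsingleton V := subsingleton_of_forall_eq a hV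
  have : Subsingleton E := subsingleton_of_forall_eq f hE
  exact isGradedUnitRegular_of_subsingleton K Γ

end LeavittPathAlgebra

theorem proposition3p5 {K : Type*} [Field K] {V E : Type*} (Γ : DirectedGraph V E)
    (hE : Nonempty E) :
    (LeavittPathAlgebra.freeGroupGrading K Γ).IsGradedUnitRegular ↔ Γ.IsLoop :=
  ⟨LeavittPathAlgebra.isLoop_of_isGradedUnitRegular,
    LeavittPathAlgebra.isGradedUnitRegular_of_isLoop⟩
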